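/- Let $\Phi$ be a homogeneous Poisson point process of density $\lambda_0>0$ in $\mathbb{R}^2$, let $\Psi=\Phi\cup\{\mathbf o\}$ with $\mathbf o$ the origin, and let $R_c\ge 0$. Let $\mathcal V=\{\mathbf x\in\mathbb{R}^2:\|\mathbf x\|\le\|\mathbf x-\mathbf b\|\ \text{for all}\ \mathbf b\in\Psi\}$ be the typical Voronoi cell, let $\mathcal X_C=\{\mathbf x\in\mathcal V:\|\mathbf x\|\le R_c\}$ be its cell-centre region (Johnson–Mehl cell), and let $X_C=|\mathcal X_C|$ be the area of this region. Then $X_C$ and $X_C^2$ are integrable, $$\mathbb E[X_C]=\frac{1-\exp(-\pi\lambda_0R_c^2)}{\lambda_0},$$ and $$\mathbb E[X_C^2]=2\pi\int_{0}^{R_c}\int_{0}^{R_c}\int_{0}^{2\pi}\exp\bigl(-\lambda_0V(r_1,r_2,u)\bigr)\,du\;r_2\,dr_2\;r_1\,dr_1 .$$ Here $$V(r_1,r_2,u)=r_1^2\Bigl(\pi-v+\tfrac{\sin 2v}{2}\Bigr)+r_2^2\Bigl(\pi-w+\tfrac{\sin 2w}{2}\Bigr),$$ $$v=\cos^{-1}\!\left(\frac{r_1-r_2\cos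 u}{\sqrt{r_1^2+r_2^2-2r_1r_2\cos u}}\right),\qquad w=\cos^{-1}\!\left(\frac{r_2-r_1\cos u}{\sqrt{r_1^2+r_2^2-2r_1r_2\cos u}}\right)$$ (with the fractions read as $0$ where the two centres coincide). For all $r_1,r_2\ge 0$ and $u\in[0,2\pi]$, $V(r_1,r_2,u)$ is the area of the union of two discs of radii $r_1$ and $r_2$ whose boundaries pass through the origin and whose centres have angular separation $u$ as seen from the origin. -/

import Mathlib

open MeasureTheory ProbabilityTheory Set

noncomputable section

/-- The Euclidean plane. -/
abbrev Plane : Type := EuclideanSpace ℝ (Fin 2)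

/-- The number of points of the configuration `Ψ` in the set `B` (possibly infinite). -/
def pointCount (Ψ B : Set Plane) : ℕ∞ := (Ψ ∩ B).encard

/-- `Φ` is a homogeneous Poisson point process of density `lam` in the plane, defined on the
probability space `(Ω, P)`: a random locally finite set of points whose numbers of points in
Borel sets are random variables, Poisson with mean `lam * |B|` for every Borel set `B` of finite
area, and independent for pairwise disjoint Borel sets. -/
structure IsHomogeneousPPP {Ω : Type*} [MeasurableSpace Ω] (P : Measure Ω)
    (Φ : Ω → Set Plane) (lam : ℝ) : Prop where
  locallyFinite : ∀ (ω : Ω) (K : Set Plane), IsCompact K → (Φ ω ∩ K).Finite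
  measurable_count : ∀ B : Set Plane, MeasurableSet B → Measurable fun ω => pointCount (Φ ω) B
  poisson_count : ∀ B : Set Plane, MeasurableSet B → volume B ≠ ⊤ →
    P.map (fun ω => pointCount (Φ ω) B) =
      (poissonMeasure (lam * volume.real B).toNNReal).map (Nat.cast : ℕ → ℕ∞)
  indep_count : ∀ (n : ℕ) (B : Fin n → Set Plane), (∀ i, MeasurableSet (B i)) →
    Pairwise (fun i j => Disjoint (B i) (B j)) →
    iIndepFun (fun i ω => pointCount (Φ ω) (B i)) P

/-- The base stations seen from the typical one: the points of `Φ` together with the origin. -/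
def withOrigin (Φ : Set Plane) : Set Plane := Φ ∪ {0}

/-- The Voronoi cell of `c` with respect to the set `Ψ`. -/
def voronoiCell (Ψ : Set Plane) (c : Plane) : Set Plane :=
  {x | ∀ b ∈ Ψ, dist x c ≤ dist x b}

/-- The cell-centre region (Johnson–Mehl cell) of `c`: the points of the Voronoi cell of `c`
at distance at most `R` from `c`. -/
def cellCentre (Ψ : Set Plane) (c : Plane) (R : ℝ) : Set Plane :=
  {x | x ∈ voronoiCell Ψ c ∧ dist x c ≤ R}

/-- The area of the cell-centre region of the typical cell, the cell of the origin in `Φ ∪ {0}`. -/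
def cellCentreArea (Φ : Set Plane) (R : ℝ) : ℝ :=
  volume.real (cellCentre (withOrigin Φ) 0 R)

/-- The distance between points with polar radii `r₁`, `r₂` and angular separation `u`. -/
def centreDist (r₁ r₂ u : ℝ) : ℝ :=
  Real.sqrt (r₁ ^ 2 + r₂ ^ 2 - 2 * r₁ * r₂ * Real.cos u)

/-- The angle `v(r₁, r₂, u)`; the angle `w(r₁, r₂, u)` is `unionAngle r₂ r₁ u`. -/
def unionAngle (r₁ r₂ u : ℝ) : ℝ :=
  Real.arccos ((r₁ - r₂ * Real.cos u) / centreDist r₁ r₂ u)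

/-- The closed formula `V(r₁, r₂, u)` for the area of the union of two discs of radii `r₁`, `r₂`
through the origin, the angular separation of their centres being `u`. -/
def unionArea (r₁ r₂ u : ℝ) : ℝ :=
  r₁ ^ 2 * (Real.pi - unionAngle r₁ r₂ u + Real.sin (2 * unionAngle r₁ r₂ u) / 2) +
  r₂ ^ 2 * (Real.pi - unionAngle r₂ r₁ u + Real.sin (2 * unionAngle r₂ r₁ u) / 2)

/-- The point of the plane with polar coordinates `(r, θ)`. -/
def polarPoint (r θ : ℝ) : Plane := !₂[r * Real.cos θ, r * Real.sin θ]

end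

/-! A point `x` lies in the cell-centre region exactly when `‖x‖ ≤ R` and the open disc about `x`
through the origin contains no point of `Φ` (`mem_cellCentre_iff`). By Tonelli, the first two
moments of the area are integrals, over one point or a pair of points, of the probability that these
points lie in the region. Each such probability is a Poisson void probability `exp(-λ|B|)`, with `B`
one disc or the union of two. In polar coordinates the area of the union depends only on the two
radii and the angular separation, so one angle integrates to `2π`.

The closed formula for that area (`volume_real_union_discs`) also comes from polar coordinates. The
disc through the origin with centre `(r, θ)` is `ρ ≤ 2 r cos(φ - θ)`, so the union has area `2 ∫
max(r₁ cos φ, r₂ cos(φ - u), 0)² dφ`. For `u ∈ [0, π]` and distinct centres at distance `d`, `r₁ cos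
φ - r₂ cos(φ - u) = d cos(φ + v)`, so the maximum changes branch at `φ = π/2 - v`. Each branch is an
integral of `cos²`, and `u + v + w = π` matches the endpoints. -/

/-! ### Polar coordinates in the plane -/

theorem measurePreserving_plane_mk :
    MeasurePreserving (fun p : ℝ × ℝ => (!₂[p.1, p.2] : Plane)) volume volume := by
  have h := (PiLp.volume_preserving_toLp (Fin 2)).comp (volume_preserving_finTwoArrow ℝ).symm
  have e : (fun p : ℝ × ℝ => (!₂[p.1, p.2] : Plane)) =
      WithLp.toLp 2 ∘ MeasurableEquiv.finTwoArrow.symm := by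
    funext p
    refine PiLp.ext fun i => ?_
    fin_cases i <;> simp [MeasurableEquiv.finTwoArrow]
  rw [e]
  exact h

theorem continuous_polarPoint : Continuous fun p : ℝ × ℝ => polarPoint p.1 p.2 := by
  unfold polarPoint
  refine (PiLp.continuous_toLp 2 _).comp (continuous_pi fun i => ?_)
  fin_cases i <;> simp <;> fun_prop

theorem lintegral_plane_eq_polar_prod (f : Plane → ENNReal) (hf : Measurable f) :
    ∫⁻ x, f x = ∫⁻ p, ENNReal.ofReal p.1 * f (polarPoint p.1 p.2)
      ∂((volume.restrict (Ioi (0 : ℝ))).prod (volume.restrict (Ioo (-Real.pi) Real.pi))) := by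
  rw [← measurePreserving_plane_mk.lintegral_comp hf, ← lintegral_comp_polarCoord_symm,
    Measure.prod_restrict]
  rfl

theorem measurable_polar_integrand (f : Plane → ENNReal) (hf : Measurable f) :
    Measurable fun p : ℝ × ℝ => ENNReal.ofReal p.1 * f (polarPoint p.1 p.2) :=
  (ENNReal.measurable_ofReal.comp measurable_fst).mul (hf.comp continuous_polarPoint.measurable)

theorem lintegral_plane_eq_polar (f : Plane → ENNReal) (hf : Measurable f) :
    ∫⁻ x, f x = ∫⁻ r in Ioi (0 : ℝ), ENNReal.ofReal r *
      ∫⁻ θ in Ioo (-Real.pi) Real.pi, f (polarPoint r θ) := by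
  rw [lintegral_plane_eq_polar_prod f hf,
    lintegral_prod _ (measurable_polar_integrand f hf).aemeasurable]
  refine lintegral_congr fun r => ?_
  have : Continuous fun θ => polarPoint r θ := continuous_polarPoint.comp (Continuous.prodMk_right r)
  exact lintegral_const_mul (ENNReal.ofReal r) (hf.comp this.measurable : Measurable fun θ => f (polarPoint r θ))

theorem lintegral_plane_eq_polar_symm (f : Plane → ENNReal) (hf : Measurable f) :
    ∫⁻ x, f x = ∫⁻ θ in Ioo (-Real.pi) Real.pi, ∫⁻ r in Ioi (0 : ℝ), ENNReal.ofReal r *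
      f (polarPoint r θ) := by
  rw [lintegral_plane_eq_polar_prod f hf,
    lintegral_prod_symm _ (measurable_polar_integrand f hf).aemeasurable]

theorem norm_polarPoint {r : ℝ} (hr : 0 ≤ r) (θ : ℝ) : ‖polarPoint r θ‖ = r := by
  rw [EuclideanSpace.norm_eq, Fin.sum_univ_two]
  simp only [polarPoint, Real.norm_eq_abs, sq_abs]
  simp only [Matrix.cons_val_zero, Matrix.cons_val_one]
  rw [show (r * Real.cos θ) ^ 2 + (r * Real.sin θ) ^ 2 = r ^ 2 by
    rw [mul_pow, mul_pow, ← mul_add, Real.cos_sq_add_sin_sq, mul_one], Real.sqrt_sq hr]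

/-- The squared distance minus `r²` factors as `ρ (ρ - 2 r cos(φ - θ))`, and `ρ > 0` can be
cancelled. -/
theorem dist_polarPoint_le_iff {r ρ : ℝ} (hr : 0 ≤ r) (hρ : 0 < ρ) (θ φ : ℝ) :
    dist (polarPoint ρ φ) (polarPoint r θ) ≤ r ↔ ρ ≤ 2 * (r * Real.cos (φ - θ)) := by
  rw [EuclideanSpace.dist_eq, Fin.sum_univ_two, Real.sqrt_le_left hr, Real.cos_sub]
  simp only [polarPoint, Real.dist_eq, sq_abs]
  simp only [Matrix.cons_val_zero, Matrix.cons_val_one]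
  have h : (ρ * Real.cos φ - r * Real.cos θ) ^ 2 + (ρ * Real.sin φ - r * Real.sin θ) ^ 2 - r ^ 2 =
      ρ * (ρ - 2 * (r * (Real.cos φ * Real.cos θ + Real.sin φ * Real.sin θ))) := by
    linear_combination ρ ^ 2 * Real.cos_sq_add_sin_sq φ + r ^ 2 * Real.cos_sq_add_sin_sq θ
  rw [← sub_nonpos, h, mul_nonpos_iff_pos_imp_nonpos]
  constructor
  · intro h; linarith [h.1 hρ]
  · intro h; exact ⟨fun _ => by linarith, fun h' => hρ.le⟩

theorem lintegral_ofReal_Ioc {R : ℝ} {g : ℝ → ℝ} (hR : 0 ≤ R)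
    (hg : IntegrableOn g (Ioc 0 R)) (h0 : ∀ r ∈ Ioc 0 R, 0 ≤ g r) :
    ∫⁻ r in Ioc 0 R, ENNReal.ofReal (g r) = ENNReal.ofReal (∫ r in (0 : ℝ)..R, g r) := by
  rw [intervalIntegral.integral_of_le hR, ofReal_integral_eq_lintegral_ofReal hg]
  exact (ae_restrict_iff' measurableSet_Ioc).2 (ae_of_all _ h0)

theorem lintegral_ofReal_mul_indicator_le {R : ℝ} (F : ℝ → ENNReal) :
    ∫⁻ r in Ioi (0 : ℝ), ENNReal.ofReal r * (Iic R).indicator F r =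
      ∫⁻ r in Ioc 0 R, ENNReal.ofReal r * F r := by
  have h : (fun r => ENNReal.ofReal r * (Iic R).indicator F r) =
      (Iic R).indicator fun r => ENNReal.ofReal r * F r := by
    ext r
    by_cases hr : r ∈ Iic R <;> simp [hr]
  rw [h, lintegral_indicator measurableSet_Iic, Measure.restrict_restrict measurableSet_Iic,
    inter_comm, Ioi_inter_Iic]

theorem lintegral_radial_indicator_Iic (M : ℝ) :
    ∫⁻ r in Ioi (0 : ℝ), ENNReal.ofReal r * (Iic M).indicator 1 r =
      ENNReal.ofReal (max M 0 ^ 2 / 2) := by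
  rw [lintegral_ofReal_mul_indicator_le]
  rcases le_total M 0 with hM | hM
  · simp [Ioc_eq_empty_of_le hM, max_eq_right hM]
  · simp only [Pi.one_apply, mul_one]
    rw [lintegral_ofReal_Ioc (g := fun r => r) hM ((continuous_id.integrableOn_Icc).mono_set Ioc_subset_Icc_self)
      (fun r hr => hr.1.le), integral_id, max_eq_left hM]
    simp

/-! ### Area of the union as an angular integral -/

/-- The squared radial function of the union of two discs through the origin is four times this. -/
noncomputable def unionRadial (r₁ r₂ u φ : ℝ) : ℝ :=
  max (max (r₁ * Real.cos φ) (r₂ * Real.cos (φ - u))) 0 ^ 2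

theorem continuous_unionRadial (r₁ r₂ u : ℝ) : Continuous (unionRadial r₁ r₂ u) := by
  unfold unionRadial; fun_prop

theorem unionRadial_periodic (r₁ r₂ u : ℝ) :
    Function.Periodic (unionRadial r₁ r₂ u) (2 * Real.pi) := by
  intro φ
  unfold unionRadial
  rw [Real.cos_add_two_pi, add_sub_right_comm, Real.cos_add_two_pi]

theorem volume_real_union_eq_integral {r₁ r₂ : ℝ} (h₁ : 0 ≤ r₁) (h₂ : 0 ≤ r₂) (u θ : ℝ) :
    volume.real (Metric.closedBall (polarPoint r₁ θ) r₁ ∪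
        Metric.closedBall (polarPoint r₂ (θ + u)) r₂) =
      2 * ∫ φ in (-(Real.pi / 2))..(-(Real.pi / 2) + 2 * Real.pi), unionRadial r₁ r₂ u φ := by
  have hpi := Real.pi_pos
  set S := Metric.closedBall (polarPoint r₁ θ) r₁ ∪
        Metric.closedBall (polarPoint r₂ (θ + u)) r₂ with hS
  have hSm : MeasurableSet S :=
    Metric.isClosed_closedBall.measurableSet.union Metric.isClosed_closedBall.measurableSet
  have hcont : Continuous fun φ => 2 * unionRadial r₁ r₂ u (φ - θ) :=
    continuous_const.mul ((continuous_unionRadial r₁ r₂ u).comp (by fun_prop))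
  have hper : Function.Periodic (fun φ => 2 * unionRadial r₁ r₂ u (φ - θ)) (2 * Real.pi) := by
    intro φ
    simp only [add_sub_right_comm, (unionRadial_periodic r₁ r₂ u) (φ - θ)]
  have hvol : volume S = ENNReal.ofReal (∫ φ in (-Real.pi)..Real.pi,
      2 * unionRadial r₁ r₂ u (φ - θ)) := by
    rw [← lintegral_indicator_one hSm,
      lintegral_plane_eq_polar_symm _ (measurable_one.indicator hSm),
      intervalIntegral.integral_of_le (by linarith), ofReal_integral_eq_lintegral_ofReal
        ((hcont.integrableOn_Icc).mono_set Ioc_subset_Icc_self)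
        (ae_of_all _ fun φ => by unfold unionRadial; positivity),
      ← restrict_Ioo_eq_restrict_Ioc]
    refine lintegral_congr fun φ => ?_
    have : ∀ r ∈ Ioi (0 : ℝ), ENNReal.ofReal r * S.indicator 1 (polarPoint r φ) =
        ENNReal.ofReal r * (Iic (2 * max (r₁ * Real.cos (φ - θ))
          (r₂ * Real.cos (φ - θ - u)))).indicator 1 r := by
      intro r hr
      congr 1
      refine indicator_eq_indicator ?_ rfl
      rw [hS, mem_union, Metric.mem_closedBall, Metric.mem_closedBall,
        dist_polarPoint_le_iff h₁ hr, dist_polarPoint_le_iff h₂ hr, mem_Iic,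
        mul_max_of_nonneg _ _ zero_le_two, le_max_iff, sub_add_eq_sub_sub]
    rw [setLIntegral_congr_fun measurableSet_Ioi this, lintegral_radial_indicator_Iic]
    congr 1
    unfold unionRadial
    rw [show (0 : ℝ) = 2 * 0 by simp, ← mul_max_of_nonneg _ _ zero_le_two]
    simp only [mul_zero]
    ring
  rw [measureReal_def, hvol, ENNReal.toReal_ofReal]
  -- The period is moved to start at `-π/2 + θ`; the substitution `φ - θ` then removes `θ` and
  -- starts the integral where the arc of the first disc begins.
  · have := hper.intervalIntegral_add_eq (-Real.pi) (-(Real.pi / 2) + θ)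
    rw [show -Real.pi + 2 * Real.pi = Real.pi by ring] at this
    rw [this, ← intervalIntegral.integral_const_mul]
    have h2 := intervalIntegral.integral_comp_sub_right
      (a := -(Real.pi / 2) + θ) (b := -(Real.pi / 2) + θ + 2 * Real.pi)
      (fun φ => 2 * unionRadial r₁ r₂ u φ) θ
    rw [h2]
    congr 1 <;> ring
  · exact intervalIntegral.integral_nonneg (by linarith)
      (fun φ _ => by unfold unionRadial; positivity)

/-! ### The triangle of the origin and the two centres -/

theorem centreDist_sq (r₁ r₂ u : ℝ) :
    centreDist r₁ r₂ u ^ 2 = (r₁ - r₂ * Real.cos u) ^ 2 + (r₂ * Real.sin u) ^ 2 := by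
  have h : r₁ ^ 2 + r₂ ^ 2 - 2 * r₁ * r₂ * Real.cos u =
      (r₁ - r₂ * Real.cos u) ^ 2 + (r₂ * Real.sin u) ^ 2 := by
    linear_combination -r₂ ^ 2 * Real.cos_sq_add_sin_sq u
  rw [centreDist, h, Real.sq_sqrt (by positivity)]

theorem centreDist_nonneg (r₁ r₂ u : ℝ) : 0 ≤ centreDist r₁ r₂ u := Real.sqrt_nonneg _

theorem centreDist_comm (r₁ r₂ u : ℝ) : centreDist r₁ r₂ u = centreDist r₂ r₁ u := by
  unfold centreDist; congr 1; ring

theorem centreDist_mul_cos_unionAngle {r₁ r₂ u : ℝ} (hd : 0 < centreDist r₁ r₂ u) :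
    centreDist r₁ r₂ u * Real.cos (unionAngle r₁ r₂ u) = r₁ - r₂ * Real.cos u := by
  have h := abs_le_of_sq_le_sq' (a := r₁ - r₂ * Real.cos u) (b := centreDist r₁ r₂ u)
    (by rw [centreDist_sq]; nlinarith [sq_nonneg (r₂ * Real.sin u)]) hd.le
  rw [unionAngle, Real.cos_arccos, mul_div_cancel₀ _ hd.ne']
  · rw [le_div_iff₀ hd]; linarith
  · rw [div_le_one hd]; linarith

theorem sin_unionAngle_nonneg (r₁ r₂ u : ℝ) : 0 ≤ Real.sin (unionAngle r₁ r₂ u) :=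
  Real.sin_nonneg_of_nonneg_of_le_pi (Real.arccos_nonneg _) (Real.arccos_le_pi _)

/-- For `u ∈ [0, π]` both sides are nonnegative, so comparing squares suffices. -/
theorem centreDist_mul_sin_unionAngle {r₁ r₂ u : ℝ} (h₂ : 0 ≤ r₂) (hu : u ∈ Icc 0 Real.pi)
    (hd : 0 < centreDist r₁ r₂ u) :
    centreDist r₁ r₂ u * Real.sin (unionAngle r₁ r₂ u) = r₂ * Real.sin u := by
  have hs := Real.sin_nonneg_of_mem_Icc hu
  rw [← sq_eq_sq₀ (mul_nonneg hd.le (sin_unionAngle_nonneg _ _ _)) (mul_nonneg h₂ hs),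
    mul_pow, Real.sin_sq, mul_sub, ← mul_pow, centreDist_mul_cos_unionAngle hd, centreDist_sq]
  ring

/-- The angles of the triangle formed by the origin and the two centres add up to `π`. -/
theorem add_unionAngle_add_unionAngle {r₁ r₂ u : ℝ} (h₁ : 0 ≤ r₁) (h₂ : 0 ≤ r₂)
    (hu : u ∈ Icc 0 Real.pi) (hd : 0 < centreDist r₁ r₂ u) :
    u + unionAngle r₁ r₂ u + unionAngle r₂ r₁ u = Real.pi := by
  have hd' : 0 < centreDist r₂ r₁ u := centreDist_comm r₁ r₂ u ▸ hd
  have c₁ := centreDist_mul_cos_unionAngle hd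
  have s₁ := centreDist_mul_sin_unionAngle h₂ hu hd
  have c₂ := centreDist_mul_cos_unionAngle hd'
  have s₂ := centreDist_mul_sin_unionAngle h₁ hu hd'
  rw [← centreDist_comm] at c₂ s₂
  have hv := Real.arccos_nonneg ((r₁ - r₂ * Real.cos u) / centreDist r₁ r₂ u)
  have hv' := Real.arccos_le_pi ((r₁ - r₂ * Real.cos u) / centreDist r₁ r₂ u)
  have hw := Real.arccos_nonneg ((r₂ - r₁ * Real.cos u) / centreDist r₂ r₁ u)
  have hw' := Real.arccos_le_pi ((r₂ - r₁ * Real.cos u) / centreDist r₂ r₁ u)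
  change 0 ≤ unionAngle r₁ r₂ u at hv
  change unionAngle r₁ r₂ u ≤ Real.pi at hv'
  change 0 ≤ unionAngle r₂ r₁ u at hw
  change unionAngle r₂ r₁ u ≤ Real.pi at hw'
  have hsw := sin_unionAngle_nonneg r₂ r₁ u
  generalize unionAngle r₁ r₂ u = v at *
  generalize unionAngle r₂ r₁ u = w at *
  generalize centreDist r₁ r₂ u = d at *
  -- Both `u + v` and `π - w` have the same cosine and sine. Cosine is injective on `[0, π]`, so
  -- only `u + v > π` has to be excluded.
  have hcos : Real.cos (u + v) = Real.cos (Real.pi - w) := by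
    apply mul_left_cancel₀ hd.ne'
    rw [Real.cos_add, Real.cos_pi_sub]
    linear_combination Real.cos u * c₁ - Real.sin u * s₁ + c₂ - r₂ * Real.cos_sq_add_sin_sq u
  have hsin : Real.sin (u + v) = Real.sin w := by
    apply mul_left_cancel₀ hd.ne'
    rw [Real.sin_add]
    linear_combination Real.sin u * c₁ + Real.cos u * s₁ - s₂
  rcases le_or_gt (u + v) Real.pi with h | h
  · have := Real.injOn_cos ⟨add_nonneg hu.1 hv, h⟩ ⟨by linarith, by linarith⟩ hcos
    linarith
  -- For `π < u + v < 2π` the sine would be negative, against `sin w ≥ 0`. If `u = v = π`, then `c₁`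
  -- reads `-d = r₁ + r₂`, against `d > 0`.
  · exfalso
    rcases (add_le_add hu.2 hv').lt_or_eq with h' | h'
    · have := Real.sin_pos_of_pos_of_lt_pi (x := u + v - Real.pi) (by linarith) (by linarith)
      rw [Real.sin_sub_pi] at this
      linarith
    · have hu' : u = Real.pi := le_antisymm hu.2 (by linarith)
      have hv'' : v = Real.pi := by linarith
      rw [hu', hv''] at c₁
      simp only [Real.cos_pi] at c₁
      linarith

/-! ### Evaluation of the angular integral -/

theorem integral_cos_sq_to_pi_div_two_sub (v : ℝ) :
    ∫ φ in (-(Real.pi / 2))..(Real.pi / 2 - v), Real.cos φ ^ 2 =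
      (Real.pi - v + Real.sin (2 * v) / 2) / 2 := by
  rw [integral_cos_sq, Real.cos_pi_div_two_sub, Real.sin_pi_div_two_sub, Real.cos_neg,
    Real.cos_pi_div_two, Real.sin_two_mul]
  ring

/-- The reflection `φ ↦ u - φ` swaps the two discs, so the arc of the second disc reduces to that of
the first. -/
theorem unionRadial_comm_reflect (r₁ r₂ u φ : ℝ) :
    unionRadial r₁ r₂ u φ = unionRadial r₂ r₁ u (u - φ) := by
  unfold unionRadial
  rw [max_comm (r₁ * _), sub_sub_cancel_left, Real.cos_neg, ← Real.cos_neg (φ - u), neg_sub]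

/-- On this arc `r₁ cos φ - r₂ cos(φ - u) = d cos(φ + v) ≥ 0`, so the first disc reaches farther and
the integrand is `r₁² cos² φ`. -/
theorem integral_unionRadial_first {r₁ r₂ u : ℝ} (h₁ : 0 ≤ r₁) (h₂ : 0 ≤ r₂)
    (hu : u ∈ Icc 0 Real.pi) (hd : 0 < centreDist r₁ r₂ u) :
    ∫ φ in (-(Real.pi / 2))..(Real.pi / 2 - unionAngle r₁ r₂ u), unionRadial r₁ r₂ u φ =
      r₁ ^ 2 * ((Real.pi - unionAngle r₁ r₂ u + Real.sin (2 * unionAngle r₁ r₂ u) / 2) / 2) := by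
  have hv : 0 ≤ unionAngle r₁ r₂ u := Real.arccos_nonneg _
  have hv' : unionAngle r₁ r₂ u ≤ Real.pi := Real.arccos_le_pi _
  rw [← integral_cos_sq_to_pi_div_two_sub, ← intervalIntegral.integral_const_mul]
  refine intervalIntegral.integral_congr fun φ hφ => ?_
  rw [uIcc_of_le (by linarith)] at hφ
  have hc : 0 ≤ Real.cos φ := Real.cos_nonneg_of_mem_Icc ⟨hφ.1, by linarith [hφ.2]⟩
  have hc' : 0 ≤ Real.cos (φ + unionAngle r₁ r₂ u) :=
    Real.cos_nonneg_of_mem_Icc ⟨by linarith [hφ.1], by linarith [hφ.2]⟩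
  have hle : r₂ * Real.cos (φ - u) ≤ r₁ * Real.cos φ := by
    have := mul_nonneg hd.le hc'
    rw [Real.cos_add] at this
    rw [Real.cos_sub]
    have e : centreDist r₁ r₂ u * (Real.cos φ * Real.cos (unionAngle r₁ r₂ u) -
        Real.sin φ * Real.sin (unionAngle r₁ r₂ u)) = r₁ * Real.cos φ -
        r₂ * (Real.cos φ * Real.cos u + Real.sin φ * Real.sin u) := by
      linear_combination Real.cos φ * centreDist_mul_cos_unionAngle hd -
        Real.sin φ * centreDist_mul_sin_unionAngle h₂ hu hd
    linarith
  simp only [unionRadial]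
  rw [max_eq_left hle, max_eq_left (mul_nonneg h₁ hc), mul_pow]

/-- The period is cut at `π/2 - v` and `u + π/2`: the first disc dominates, then the second, then
neither is met. -/
theorem integral_unionRadial {r₁ r₂ u : ℝ} (h₁ : 0 ≤ r₁) (h₂ : 0 ≤ r₂)
    (hu : u ∈ Icc 0 Real.pi) (hd : 0 < centreDist r₁ r₂ u) :
    2 * ∫ φ in (-(Real.pi / 2))..(-(Real.pi / 2) + 2 * Real.pi), unionRadial r₁ r₂ u φ =
      unionArea r₁ r₂ u := by
  have hd' : 0 < centreDist r₂ r₁ u := centreDist_comm r₁ r₂ u ▸ hd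
  have hsum := add_unionAngle_add_unionAngle h₁ h₂ hu hd
  have hint : ∀ a b, IntervalIntegrable (unionRadial r₁ r₂ u) volume a b := fun a b =>
    (continuous_unionRadial r₁ r₂ u).intervalIntegrable a b
  have hB : ∫ φ in (Real.pi / 2 - unionAngle r₁ r₂ u)..(u + Real.pi / 2), unionRadial r₁ r₂ u φ =
      r₂ ^ 2 * ((Real.pi - unionAngle r₂ r₁ u + Real.sin (2 * unionAngle r₂ r₁ u) / 2) / 2) := by
    rw [← integral_unionRadial_first h₂ h₁ hu hd']
    simp_rw [unionRadial_comm_reflect r₁ r₂]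
    rw [intervalIntegral.integral_comp_sub_left (fun φ => unionRadial r₂ r₁ u φ)]
    -- Reflection sends the endpoint `π/2 - v` to `u + v - π/2`, which is `π/2 - w` by the angle
    -- sum.
    congr 1 <;> linarith
  have hC : ∫ φ in (u + Real.pi / 2)..(-(Real.pi / 2) + 2 * Real.pi),
      unionRadial r₁ r₂ u φ = 0 := by
    rw [← intervalIntegral.integral_zero (a := u + Real.pi / 2)
      (b := -(Real.pi / 2) + 2 * Real.pi) (μ := volume)]
    refine intervalIntegral.integral_congr fun φ hφ => ?_
    rw [uIcc_of_le (by linarith [hu.2])] at hφ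
    have k₁ : Real.cos φ ≤ 0 := Real.cos_nonpos_of_pi_div_two_le_of_le
      (by linarith [hφ.1, hu.1]) (by linarith [hφ.2])
    have k₂ : Real.cos (φ - u) ≤ 0 := Real.cos_nonpos_of_pi_div_two_le_of_le
      (by linarith [hφ.1, hu.1]) (by linarith [hφ.2, hu.1])
    simp only [unionRadial]
    rw [max_eq_right (max_le (mul_nonpos_of_nonneg_of_nonpos h₁ k₁)
      (mul_nonpos_of_nonneg_of_nonpos h₂ k₂))]
    simp
  rw [← intervalIntegral.integral_add_adjacent_intervals (hint _ (u + Real.pi / 2)) (hint _ _), hC,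
    ← intervalIntegral.integral_add_adjacent_intervals
      (hint _ (Real.pi / 2 - unionAngle r₁ r₂ u)) (hint _ _), hB,
    integral_unionRadial_first h₁ h₂ hu hd]
  unfold unionArea
  ring

theorem volume_real_closedBall_plane (x : Plane) {r : ℝ} (hr : 0 ≤ r) :
    volume.real (Metric.closedBall x r) = Real.pi * r ^ 2 := by
  rw [measureReal_def, EuclideanSpace.volume_closedBall_fin_two, ENNReal.toReal_mul,
    ENNReal.toReal_pow, ENNReal.toReal_ofReal hr, ENNReal.toReal_ofReal Real.pi_pos.le, mul_comm]

theorem integral_unionRadial_degenerate {r₁ r₂ u : ℝ} (h₁ : 0 ≤ r₁)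
    (hd : centreDist r₁ r₂ u = 0) :
    2 * ∫ φ in (-(Real.pi / 2))..(-(Real.pi / 2) + 2 * Real.pi), unionRadial r₁ r₂ u φ =
      unionArea r₁ r₂ u := by
  have hs := centreDist_sq r₁ r₂ u
  rw [hd] at hs
  have e₁ : r₂ * Real.cos u = r₁ := by nlinarith [sq_nonneg (r₁ - r₂ * Real.cos u), sq_nonneg (r₂ * Real.sin u)]
  have e₂ : r₂ * Real.sin u = 0 := by nlinarith [sq_nonneg (r₁ - r₂ * Real.cos u), sq_nonneg (r₂ * Real.sin u)]
  have e₃ : r₁ ^ 2 = r₂ ^ 2 := by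
    linear_combination -(r₁ + r₂ * Real.cos u) * e₁ + r₂ ^ 2 * Real.cos_sq_add_sin_sq u -
      r₂ * Real.sin u * e₂
  have hU : ∀ φ, unionRadial r₁ r₂ u φ = max (r₁ * Real.cos φ) 0 ^ 2 := by
    intro φ
    have : r₂ * Real.cos (φ - u) = r₁ * Real.cos φ := by
      rw [Real.cos_sub]
      linear_combination Real.cos φ * e₁ + Real.sin φ * e₂
    rw [unionRadial, this, max_self]
  -- With coinciding centres the fractions are `0`, so `v = w = π/2` and each summand is half the
  -- common disc.
  have ha : unionArea r₁ r₂ u = Real.pi * r₁ ^ 2 := by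
    have hd' := centreDist_comm r₁ r₂ u ▸ hd
    unfold unionArea unionAngle
    rw [hd, hd', div_zero, div_zero, Real.arccos_zero, ← e₃, mul_div_cancel₀ _ two_ne_zero,
      Real.sin_pi]
    ring
  -- A disc united with itself evaluates the remaining integral.
  have hb := volume_real_union_eq_integral h₁ h₁ 0 0
  rw [add_zero, union_self, volume_real_closedBall_plane _ h₁] at hb
  rw [ha, hb]
  congr 2
  ext φ
  rw [hU, unionRadial, sub_zero, max_self]

/-! ### Extension to arbitrary angular separation -/

theorem unionAngle_periodic (r₁ r₂ : ℝ) : Function.Periodic (unionAngle r₁ r₂) (2 * Real.pi) := by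
  intro u
  simp only [unionAngle, centreDist, Real.cos_add_two_pi]

theorem unionArea_periodic (r₁ r₂ : ℝ) : Function.Periodic (unionArea r₁ r₂) (2 * Real.pi) := by
  intro u
  simp only [unionArea, unionAngle_periodic _ _ u]

theorem unionArea_neg (r₁ r₂ u : ℝ) : unionArea r₁ r₂ (-u) = unionArea r₁ r₂ u := by
  simp only [unionArea, unionAngle, centreDist, Real.cos_neg]

/-- `unionArea` is the area of the union of two discs through the origin. -/
theorem volume_real_union_discs {r₁ r₂ : ℝ} (h₁ : 0 ≤ r₁) (h₂ : 0 ≤ r₂) (u θ : ℝ) :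
    volume.real (Metric.closedBall (polarPoint r₁ θ) r₁ ∪
        Metric.closedBall (polarPoint r₂ (θ + u)) r₂) = unionArea r₁ r₂ u := by
  have hpi := Real.pi_pos
  have key : ∀ u ∈ Icc 0 Real.pi, ∀ θ, volume.real (Metric.closedBall (polarPoint r₁ θ) r₁ ∪
        Metric.closedBall (polarPoint r₂ (θ + u)) r₂) = unionArea r₁ r₂ u := by
    intro u hu θ
    rw [volume_real_union_eq_integral h₁ h₂]
    rcases (centreDist_nonneg r₁ r₂ u).eq_or_lt with hd | hd
    · exact integral_unionRadial_degenerate h₁ hd.symm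
    · exact integral_unionRadial h₁ h₂ hu hd
  have hper : Function.Periodic (fun u => ∫ φ in (-(Real.pi / 2))..(-(Real.pi / 2) + 2 * Real.pi),
      unionRadial r₁ r₂ u φ) (2 * Real.pi) := by
    intro u
    simp only [unionRadial, ← sub_sub, Real.cos_sub_two_pi]
  have hsymm : ∀ u, ∫ φ in (-(Real.pi / 2))..(-(Real.pi / 2) + 2 * Real.pi),
      unionRadial r₁ r₂ (-u) φ = ∫ φ in (-(Real.pi / 2))..(-(Real.pi / 2) + 2 * Real.pi),
      unionRadial r₁ r₂ u φ := by
    intro u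
    have e : ∀ φ, unionRadial r₁ r₂ (-u) φ = unionRadial r₁ r₂ u (-φ) := by
      intro φ
      simp only [unionRadial]
      rw [Real.cos_neg, ← Real.cos_neg (-φ - u), show -(-φ - u) = φ - -u by ring]
    simp_rw [e]
    rw [intervalIntegral.integral_comp_neg (fun φ => unionRadial r₁ r₂ u φ)]
    have := (unionRadial_periodic r₁ r₂ u).intervalIntegral_add_eq
      (-(-(Real.pi / 2) + 2 * Real.pi)) (-(Real.pi / 2))
    rw [← this]
    congr 1
    ring
  -- Both sides are `2π`-periodic and even in the separation, so `u` is reduced to `v ∈ [-π, π)` and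
  -- then to `|v| ∈ [0, π]`.
  obtain ⟨v, hv, hveq⟩ : ∃ v ∈ Ico (-Real.pi) (-Real.pi + 2 * Real.pi),
      unionArea r₁ r₂ u = unionArea r₁ r₂ v ∧
      ∫ φ in (-(Real.pi / 2))..(-(Real.pi / 2) + 2 * Real.pi), unionRadial r₁ r₂ u φ =
      ∫ φ in (-(Real.pi / 2))..(-(Real.pi / 2) + 2 * Real.pi), unionRadial r₁ r₂ v φ := by
    refine ⟨toIcoMod Real.two_pi_pos (-Real.pi) u, toIcoMod_mem_Ico _ _ _, ?_, ?_⟩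
    · exact ((unionArea_periodic r₁ r₂).sub_zsmul_eq _).symm
    · exact (hper.sub_zsmul_eq _).symm
  rw [volume_real_union_eq_integral h₁ h₂, hveq.1, hveq.2]
  rcases le_total 0 v with h | h
  · rw [← key v ⟨h, by linarith [hv.2]⟩ 0, volume_real_union_eq_integral h₁ h₂]
  · rw [← unionArea_neg, ← hsymm, ← key (-v) ⟨by linarith, by linarith [hv.1]⟩ 0,
      volume_real_union_eq_integral h₁ h₂]

/-! ### Membership in the cell and void probabilities -/

theorem pointCount_eq_zero_iff {Ψ B : Set Plane} : pointCount Ψ B = 0 ↔ Disjoint Ψ B := by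
  rw [pointCount, Set.encard_eq_zero, Set.disjoint_iff_inter_eq_empty]

/-- The added origin imposes no condition: its distance to `x` is exactly `‖x‖`, so it is not in the
open disc. -/
theorem mem_cellCentre_iff {Ψ : Set Plane} {R : ℝ} {x : Plane} :
    x ∈ cellCentre (withOrigin Ψ) 0 R ↔ Disjoint Ψ (Metric.ball x ‖x‖) ∧ ‖x‖ ≤ R := by
  simp only [cellCentre, voronoiCell, withOrigin, mem_ofPred_eq, dist_zero_right,
    Set.disjoint_left, Metric.mem_ball, not_lt, mem_union, mem_singleton_iff]
  refine and_congr_left fun _ => ⟨fun h b hb => ?_, fun h b hb => ?_⟩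
  · rw [dist_comm]; exact h b (Or.inl hb)
  · rcases hb with hb | rfl
    · rw [dist_comm]; exact h hb
    · rw [dist_zero_right]

theorem cellCentre_subset_closedBall (Ψ : Set Plane) (R : ℝ) :
    cellCentre (withOrigin Ψ) 0 R ⊆ Metric.closedBall 0 R := fun _ hx => by
  simpa using (mem_cellCentre_iff.1 hx).2

section

variable {Ω : Type*} [MeasurableSpace Ω] {P : Measure Ω} {Φ : Ω → Set Plane} {lam : ℝ}

theorem IsHomogeneousPPP.void_probability (hΦ : IsHomogeneousPPP P Φ lam) (hlam : 0 ≤ lam)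
    {B : Set Plane} (hB : MeasurableSet B) (hfin : volume B ≠ ⊤) :
    P {ω | Disjoint (Φ ω) B} = ENNReal.ofReal (Real.exp (-(lam * volume.real B))) := by
  have h := congrArg (fun μ => μ {(0 : ℕ∞)}) (hΦ.poisson_count B hB hfin)
  rw [Measure.map_apply (hΦ.measurable_count B hB) (measurableSet_singleton _),
    Measure.map_apply (measurable_of_countable _) (measurableSet_singleton _)] at h
  have e₁ : (fun ω => pointCount (Φ ω) B) ⁻¹' {0} = {ω | Disjoint (Φ ω) B} := by
    ext ω; simp [pointCount_eq_zero_iff]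
  have e₂ : (Nat.cast : ℕ → ℕ∞) ⁻¹' {0} = {0} := by
    ext n; simp
  rw [e₁, e₂, poissonMeasure_singleton] at h
  rw [h, Real.coe_toNNReal _ (mul_nonneg hlam measureReal_nonneg)]
  simp

/-! ### Measurability and integrability of the cell area -/

/-- Only counts in fixed Borel sets are known to be measurable. This lets countably many balls
detect a point of `Φ` in a disc that varies with `x`. -/
theorem exists_rat_ball {x b : Plane} (hb : b ∈ Metric.ball x ‖x‖) :
    ∃ n, ∃ s : ℚ, b ∈ Metric.ball (TopologicalSpace.denseSeq Plane n) s ∧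
      dist (TopologicalSpace.denseSeq Plane n) x + s ≤ ‖x‖ := by
  rw [Metric.mem_ball] at hb
  -- Half the slack: the distance from the dense point to `b` and the radius `s` each use less than
  -- one half.
  obtain ⟨s, hs0, hs⟩ := exists_rat_btwn (show (0 : ℝ) < (‖x‖ - dist b x) / 2 by linarith)
  obtain ⟨n, hn⟩ := (TopologicalSpace.denseRange_denseSeq Plane).exists_dist_lt b hs0
  refine ⟨n, s, hn, ?_⟩
  have := dist_triangle (TopologicalSpace.denseSeq Plane n) b x
  rw [dist_comm _ b] at this
  linarith

/-- The complement is a countable union of rectangles: the `x` whose disc contains a given rational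
ball, times the event that this ball is hit. -/
theorem IsHomogeneousPPP.measurableSet_disjoint_ball (hΦ : IsHomogeneousPPP P Φ lam) :
    MeasurableSet {p : Plane × Ω | Disjoint (Φ p.2) (Metric.ball p.1 ‖p.1‖)} := by
  have h : {p : Plane × Ω | Disjoint (Φ p.2) (Metric.ball p.1 ‖p.1‖)} =
      (⋃ n : ℕ, ⋃ s : ℚ, {x : Plane | dist (TopologicalSpace.denseSeq Plane n) x + s ≤ ‖x‖} ×ˢ
        {ω | pointCount (Φ ω) (Metric.ball (TopologicalSpace.denseSeq Plane n) s) ≠ 0})ᶜ := by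
    ext ⟨x, ω⟩
    rw [mem_compl_iff, iff_not_comm]
    simp only [mem_iUnion, mem_prod, mem_ofPred_eq, ne_eq, pointCount_eq_zero_iff,
      Set.not_disjoint_iff]
    constructor
    · rintro ⟨n, s, hs, b, hb, hbs⟩
      refine ⟨b, hb, ?_⟩
      rw [Metric.mem_ball] at hbs ⊢
      linarith [dist_triangle b (TopologicalSpace.denseSeq Plane n) x]
    · rintro ⟨b, hb, hbx⟩
      obtain ⟨n, s, hs, hle⟩ := exists_rat_ball hbx
      exact ⟨n, s, hle, b, hb, hs⟩
  rw [h]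
  refine (MeasurableSet.iUnion fun n => MeasurableSet.iUnion fun s => ?_).compl
  refine MeasurableSet.prod ?_ ?_
  · exact (isClosed_le (by fun_prop) (by fun_prop)).measurableSet
  · exact (hΦ.measurable_count _ measurableSet_ball) (measurableSet_singleton 0).compl

theorem IsHomogeneousPPP.measurableSet_cellCentre (hΦ : IsHomogeneousPPP P Φ lam) (R : ℝ) :
    MeasurableSet {p : Plane × Ω | p.1 ∈ cellCentre (withOrigin (Φ p.2)) 0 R} := by
  simp only [mem_cellCentre_iff]
  exact hΦ.measurableSet_disjoint_ball.inter
    ((isClosed_le continuous_norm continuous_const).measurableSet.preimage measurable_fst)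

theorem IsHomogeneousPPP.measurable_volume_cellCentre (hΦ : IsHomogeneousPPP P Φ lam) (R : ℝ) :
    Measurable fun ω => volume (cellCentre (withOrigin (Φ ω)) 0 R) :=
  measurable_measure_prodMk_right (hΦ.measurableSet_cellCentre R)

theorem volume_cellCentre_ne_top (Ψ : Set Plane) (R : ℝ) :
    volume (cellCentre (withOrigin Ψ) 0 R) ≠ ⊤ :=
  ((measure_mono (cellCentre_subset_closedBall Ψ R)).trans_lt measure_closedBall_lt_top).ne

theorem ofReal_cellCentreArea (Ψ : Set Plane) (R : ℝ) :
    ENNReal.ofReal (cellCentreArea Ψ R) = volume (cellCentre (withOrigin Ψ) 0 R) :=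
  ENNReal.ofReal_toReal (volume_cellCentre_ne_top Ψ R)

theorem IsHomogeneousPPP.measurable_cellCentreArea (hΦ : IsHomogeneousPPP P Φ lam) (R : ℝ) :
    Measurable fun ω => cellCentreArea (Φ ω) R :=
  (hΦ.measurable_volume_cellCentre R).ennreal_toReal

theorem cellCentreArea_nonneg (Ψ : Set Plane) (R : ℝ) : 0 ≤ cellCentreArea Ψ R := measureReal_nonneg

theorem cellCentreArea_le (Ψ : Set Plane) (R : ℝ) :
    cellCentreArea Ψ R ≤ volume.real (Metric.closedBall (0 : Plane) R) :=
  measureReal_mono (cellCentre_subset_closedBall Ψ R) measure_closedBall_lt_top.ne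

theorem IsHomogeneousPPP.integrable_cellCentreArea_pow [IsFiniteMeasure P]
    (hΦ : IsHomogeneousPPP P Φ lam) (R : ℝ) (n : ℕ) :
    Integrable (fun ω => cellCentreArea (Φ ω) R ^ n) P := by
  refine Integrable.of_bound ((hΦ.measurable_cellCentreArea R).pow_const n).aestronglyMeasurable
    (volume.real (Metric.closedBall (0 : Plane) R) ^ n) (ae_of_all _ fun ω => ?_)
  rw [Real.norm_of_nonneg (pow_nonneg (cellCentreArea_nonneg _ _) n)]
  exact pow_le_pow_left₀ (cellCentreArea_nonneg _ _) (cellCentreArea_le _ _) n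

/-! ### Moments as integrals of probabilities -/

/-- Tonelli: both sides are the product measure of the same subset of `Plane × Ω`, sliced in the two
directions. -/
theorem IsHomogeneousPPP.lintegral_volume_cellCentre [SFinite P] (hΦ : IsHomogeneousPPP P Φ lam)
    (R : ℝ) :
    ∫⁻ ω, volume (cellCentre (withOrigin (Φ ω)) 0 R) ∂P =
      ∫⁻ x, P {ω | x ∈ cellCentre (withOrigin (Φ ω)) 0 R} :=
  (Measure.prod_apply_symm (hΦ.measurableSet_cellCentre R)).symm.trans
    (Measure.prod_apply (hΦ.measurableSet_cellCentre R))

theorem IsHomogeneousPPP.measurableSet_cellCentre_pair (hΦ : IsHomogeneousPPP P Φ lam) (R : ℝ) :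
    MeasurableSet {q : (Plane × Plane) × Ω | q.1.1 ∈ cellCentre (withOrigin (Φ q.2)) 0 R ∧
      q.1.2 ∈ cellCentre (withOrigin (Φ q.2)) 0 R} :=
  ((hΦ.measurableSet_cellCentre R).preimage
    ((measurable_fst.comp measurable_fst).prodMk measurable_snd)).inter
  ((hΦ.measurableSet_cellCentre R).preimage
    ((measurable_snd.comp measurable_fst).prodMk measurable_snd))

theorem IsHomogeneousPPP.measurable_prob_cellCentre [SFinite P] (hΦ : IsHomogeneousPPP P Φ lam)
    (R : ℝ) :
    Measurable fun x : Plane => P {ω | x ∈ cellCentre (withOrigin (Φ ω)) 0 R} :=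
  measurable_measure_prodMk_left (hΦ.measurableSet_cellCentre R)

theorem IsHomogeneousPPP.measurable_prob_cellCentre_pair [SFinite P]
    (hΦ : IsHomogeneousPPP P Φ lam) (R : ℝ) :
    Measurable fun z : Plane × Plane => P {ω | z.1 ∈ cellCentre (withOrigin (Φ ω)) 0 R ∧
      z.2 ∈ cellCentre (withOrigin (Φ ω)) 0 R} :=
  measurable_measure_prodMk_left (hΦ.measurableSet_cellCentre_pair R)

/-- The squared area is the measure of the set of pairs of points in the region, to which Tonelli
applies again. -/
theorem IsHomogeneousPPP.lintegral_volume_cellCentre_sq [SFinite P]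
    (hΦ : IsHomogeneousPPP P Φ lam) (R : ℝ) :
    ∫⁻ ω, volume (cellCentre (withOrigin (Φ ω)) 0 R) ^ 2 ∂P =
      ∫⁻ x, ∫⁻ y, P {ω | x ∈ cellCentre (withOrigin (Φ ω)) 0 R ∧
        y ∈ cellCentre (withOrigin (Φ ω)) 0 R} := by
  have h : ∀ ω, volume (cellCentre (withOrigin (Φ ω)) 0 R) ^ 2 =
      ((volume : Measure Plane).prod volume) {z : Plane × Plane |
        z.1 ∈ cellCentre (withOrigin (Φ ω)) 0 R ∧ z.2 ∈ cellCentre (withOrigin (Φ ω)) 0 R} := by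
    intro ω
    rw [sq, ← Measure.prod_prod]
    rfl
  simp_rw [h]
  have hD := hΦ.measurableSet_cellCentre_pair R
  refine (Measure.prod_apply_symm (μ := (volume : Measure Plane).prod volume) (ν := P) hD).symm.trans
    ((Measure.prod_apply hD).trans ?_)
  exact lintegral_prod _ (measurable_measure_prodMk_left hD).aemeasurable

theorem IsHomogeneousPPP.prob_mem_cellCentre (hΦ : IsHomogeneousPPP P Φ lam) (hlam : 0 ≤ lam)
    {R : ℝ} (x : Plane) :
    P {ω | x ∈ cellCentre (withOrigin (Φ ω)) 0 R} =
      (Iic R).indicator (fun r => ENNReal.ofReal (Real.exp (-(lam * (Real.pi * r ^ 2))))) ‖x‖ := by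
  simp only [mem_cellCentre_iff]
  by_cases hx : ‖x‖ ≤ R
  · rw [indicator_of_mem (mem_Iic.2 hx)]
    simp only [hx, and_true]
    rw [hΦ.void_probability hlam measurableSet_ball measure_ball_lt_top.ne, measureReal_def,
      ← Measure.addHaar_closedBall_eq_addHaar_ball, ← measureReal_def,
      volume_real_closedBall_plane x (norm_nonneg x)]
  · rw [indicator_of_notMem (by simpa using hx)]
    simp [hx]

/-- Circles are null sets. This passes from the open discs of the void event to the closed discs of
the area formula. -/
theorem volume_real_union_ball (x y : Plane) (r s : ℝ) :
    volume.real (Metric.ball x r ∪ Metric.ball y s) =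
      volume.real (Metric.closedBall x r ∪ Metric.closedBall y s) := by
  refine measureReal_congr (Filter.EventuallyEq.union ?_ ?_) <;>
  exact ae_eq_of_subset_of_measure_ge Metric.ball_subset_closedBall
    (Measure.addHaar_closedBall_eq_addHaar_ball _ _ _).le measurableSet_ball.nullMeasurableSet
    measure_closedBall_lt_top.ne

/-- Two discs are both void exactly when their union is, so a single void probability gives the
joint one. -/
theorem IsHomogeneousPPP.prob_pair_mem_cellCentre (hΦ : IsHomogeneousPPP P Φ lam)
    (hlam : 0 ≤ lam) {R r₁ r₂ : ℝ} (h₁ : 0 ≤ r₁) (h₂ : 0 ≤ r₂) (θ₁ θ₂ : ℝ) :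
    P {ω | polarPoint r₁ θ₁ ∈ cellCentre (withOrigin (Φ ω)) 0 R ∧
      polarPoint r₂ θ₂ ∈ cellCentre (withOrigin (Φ ω)) 0 R} =
    (Iic R).indicator (fun r₁ => (Iic R).indicator (fun r₂ =>
      ENNReal.ofReal (Real.exp (-(lam * unionArea r₁ r₂ (θ₂ - θ₁))))) r₂) r₁ := by
  simp only [mem_cellCentre_iff, norm_polarPoint h₁, norm_polarPoint h₂]
  by_cases hr₁ : r₁ ≤ R
  · by_cases hr₂ : r₂ ≤ R
    · rw [indicator_of_mem (mem_Iic.2 hr₁), indicator_of_mem (mem_Iic.2 hr₂),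
        ← volume_real_union_discs h₁ h₂ _ θ₁, add_sub_cancel, ← volume_real_union_ball,
        ← hΦ.void_probability hlam (measurableSet_ball.union measurableSet_ball)
          (measure_union_lt_top measure_ball_lt_top measure_ball_lt_top).ne]
      simp only [hr₁, hr₂, and_true, Set.disjoint_union_right]
    · simp [hr₂]
  · simp [hr₁]

end

/-! ### From lower integrals to real interval integrals -/

theorem lintegral_radial_indicator {R C : ℝ} (hR : 0 ≤ R) {g : ℝ → ℝ} (hg : Measurable g)
    (h0 : ∀ r ∈ Ioc 0 R, 0 ≤ g r) (hC : ∀ r ∈ Ioc 0 R, g r ≤ C) :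
    ∫⁻ r in Ioi (0 : ℝ), ENNReal.ofReal r * (Iic R).indicator (fun r => ENNReal.ofReal (g r)) r =
      ENNReal.ofReal (∫ r in (0 : ℝ)..R, g r * r) := by
  rw [lintegral_ofReal_mul_indicator_le, ← lintegral_ofReal_Ioc hR _
    (fun r hr => mul_nonneg (h0 r hr) hr.1.le)]
  · refine setLIntegral_congr_fun measurableSet_Ioc fun r hr => ?_
    rw [mul_comm, ENNReal.ofReal_mul (h0 r hr)]
  · refine IntegrableOn.of_bound measure_Ioc_lt_top
      (hg.mul measurable_id).aestronglyMeasurable (C * R) ?_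
    refine (ae_restrict_iff' measurableSet_Ioc).2 (ae_of_all _ fun r hr => ?_)
    rw [Real.norm_of_nonneg (mul_nonneg (h0 r hr) hr.1.le)]
    exact mul_le_mul (hC r hr) hr.2 hr.1.le ((h0 r hr).trans (hC r hr))

theorem lintegral_Ioo_neg_pi_pi_const (c : ENNReal) :
    ∫⁻ _ in Ioo (-Real.pi) Real.pi, c = ENNReal.ofReal (2 * Real.pi) * c := by
  rw [setLIntegral_const, Real.volume_Ioo, mul_comm]
  congr 2
  ring

theorem unionArea_nonneg {r₁ r₂ : ℝ} (h₁ : 0 ≤ r₁) (h₂ : 0 ≤ r₂) (u : ℝ) :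
    0 ≤ unionArea r₁ r₂ u :=
  volume_real_union_discs h₁ h₂ u 0 ▸ measureReal_nonneg

theorem measurable_unionArea : Measurable fun p : (ℝ × ℝ) × ℝ => unionArea p.1.1 p.1.2 p.2 := by
  unfold unionArea unionAngle centreDist
  have := Real.continuous_arccos.measurable
  fun_prop

theorem measurable_exp_unionArea (lam : ℝ) :
    Measurable fun p : (ℝ × ℝ) × ℝ => Real.exp (-(lam * unionArea p.1.1 p.1.2 p.2)) :=
  ((measurable_unionArea.const_mul lam).neg).exp

theorem exp_unionArea_le_one {lam r₁ r₂ : ℝ} (hlam : 0 ≤ lam) (h₁ : 0 ≤ r₁) (h₂ : 0 ≤ r₂) (u : ℝ) :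
    Real.exp (-(lam * unionArea r₁ r₂ u)) ≤ 1 :=
  Real.exp_le_one_iff.2 (neg_nonpos.2 (mul_nonneg hlam (unionArea_nonneg h₁ h₂ u)))

/-- The integral of `exp (-lam * V)` over the angular separation of the centres. -/
noncomputable def angularIntegral (lam r₁ r₂ : ℝ) : ℝ :=
  ∫ u in (0 : ℝ)..(2 * Real.pi), Real.exp (-(lam * unionArea r₁ r₂ u))

theorem measurable_angularIntegral (lam : ℝ) :
    Measurable fun p : ℝ × ℝ => angularIntegral lam p.1 p.2 := by
  unfold angularIntegral
  simp_rw [intervalIntegral.integral_of_le Real.two_pi_pos.le]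
  exact ((measurable_exp_unionArea lam).stronglyMeasurable.integral_prod_right
    (f := fun (p : ℝ × ℝ) u => Real.exp (-(lam * unionArea p.1 p.2 u)))).measurable

theorem angularIntegral_nonneg (lam r₁ r₂ : ℝ) : 0 ≤ angularIntegral lam r₁ r₂ :=
  intervalIntegral.integral_nonneg Real.two_pi_pos.le fun _ _ => (Real.exp_pos _).le

theorem angularIntegral_le {lam r₁ r₂ : ℝ} (hlam : 0 ≤ lam) (h₁ : 0 ≤ r₁) (h₂ : 0 ≤ r₂) :
    angularIntegral lam r₁ r₂ ≤ 2 * Real.pi := by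
  have := intervalIntegral.norm_integral_le_of_norm_le_const (a := 0) (b := 2 * Real.pi) (C := 1)
    (f := fun u => Real.exp (-(lam * unionArea r₁ r₂ u))) fun u _ => by
      rw [Real.norm_of_nonneg (Real.exp_pos _).le]
      exact exp_unionArea_le_one hlam h₁ h₂ u
  rw [sub_zero, abs_of_pos Real.two_pi_pos, one_mul] at this
  exact (le_abs_self _).trans this

/-- By periodicity in the separation the result does not depend on the direction `θ` of the first
point. -/
theorem lintegral_exp_unionArea {lam r₁ r₂ : ℝ} (hlam : 0 ≤ lam) (h₁ : 0 ≤ r₁) (h₂ : 0 ≤ r₂)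
    (θ : ℝ) :
    ∫⁻ φ in Ioo (-Real.pi) Real.pi, ENNReal.ofReal (Real.exp (-(lam * unionArea r₁ r₂ (φ - θ)))) =
      ENNReal.ofReal (angularIntegral lam r₁ r₂) := by
  have hm : Measurable fun φ => Real.exp (-(lam * unionArea r₁ r₂ (φ - θ))) :=
    (measurable_exp_unionArea lam).comp (g := fun p : (ℝ × ℝ) × ℝ =>
      Real.exp (-(lam * unionArea p.1.1 p.1.2 p.2))) (f := fun φ => ((r₁, r₂), φ - θ))
      (by fun_prop)
  have hper : Function.Periodic (fun u => Real.exp (-(lam * unionArea r₁ r₂ u))) (2 * Real.pi) := by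
    intro u
    simp only [unionArea_periodic r₁ r₂ u]
  rw [restrict_Ioo_eq_restrict_Ioc, ← ofReal_integral_eq_lintegral_ofReal _
    (ae_of_all _ fun _ => (Real.exp_pos _).le),
    ← intervalIntegral.integral_of_le (by linarith [Real.pi_pos]),
    intervalIntegral.integral_comp_sub_right (fun u => Real.exp (-(lam * unionArea r₁ r₂ u))) θ]
  · have := hper.intervalIntegral_add_eq (-Real.pi - θ) 0
    rw [zero_add, show -Real.pi - θ + 2 * Real.pi = Real.pi - θ by ring] at this
    rw [this, angularIntegral]
  · refine IntegrableOn.of_bound measure_Ioc_lt_top hm.aestronglyMeasurable 1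
      (ae_of_all _ fun φ => ?_)
    rw [Real.norm_of_nonneg (Real.exp_pos _).le]
    exact exp_unionArea_le_one hlam h₁ h₂ _

/-- The integral of `exp (-lam * V)` over the second centre, the first one being at radius `r₁`. -/
noncomputable def radialIntegral (lam R r₁ : ℝ) : ℝ :=
  ∫ r₂ in (0 : ℝ)..R, angularIntegral lam r₁ r₂ * r₂

theorem measurable_radialIntegral {R : ℝ} (hR : 0 ≤ R) (lam : ℝ) :
    Measurable (radialIntegral lam R) := by
  unfold radialIntegral
  simp_rw [intervalIntegral.integral_of_le hR]
  exact (((measurable_angularIntegral lam).mul measurable_snd).stronglyMeasurable.integral_prod_right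
    (f := fun r₁ r₂ => angularIntegral lam r₁ r₂ * r₂)).measurable

theorem radialIntegral_nonneg {R : ℝ} (hR : 0 ≤ R) (lam r₁ : ℝ) : 0 ≤ radialIntegral lam R r₁ :=
  intervalIntegral.integral_nonneg hR fun _ hr => mul_nonneg (angularIntegral_nonneg _ _ _) hr.1

theorem radialIntegral_le {lam R r₁ : ℝ} (hR : 0 ≤ R) (hlam : 0 ≤ lam) (h₁ : 0 ≤ r₁) :
    radialIntegral lam R r₁ ≤ 2 * Real.pi * R * R := by
  have := intervalIntegral.norm_integral_le_of_norm_le_const (a := 0) (b := R)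
    (C := 2 * Real.pi * R) (f := fun r₂ => angularIntegral lam r₁ r₂ * r₂) fun r hr => by
      rw [uIoc_of_le hR] at hr
      rw [Real.norm_of_nonneg (mul_nonneg (angularIntegral_nonneg _ _ _) hr.1.le)]
      exact mul_le_mul (angularIntegral_le hlam h₁ hr.1.le) hr.2 hr.1.le Real.two_pi_pos.le
  rw [sub_zero, abs_of_nonneg hR] at this
  exact (le_abs_self _).trans this

theorem integral_exp_neg_mul_sq_mul {lam : ℝ} (hlam : 0 < lam) (R : ℝ) :
    ∫ r in (0 : ℝ)..R, 2 * Real.pi * Real.exp (-(lam * (Real.pi * r ^ 2))) * r =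
      (1 - Real.exp (-(Real.pi * lam * R ^ 2))) / lam := by
  have hd : ∀ r ∈ uIcc 0 R, HasDerivAt (fun r => -Real.exp (-(lam * (Real.pi * r ^ 2))) / lam)
      (2 * Real.pi * Real.exp (-(lam * (Real.pi * r ^ 2))) * r) r := by
    intro r _
    have h := ((((((hasDerivAt_id r).pow 2).const_mul Real.pi).const_mul lam).neg.exp).neg).div_const
      lam
    convert! h using 1
    simp
    field_simp
  rw [intervalIntegral.integral_eq_sub_of_hasDerivAt hd
    (Continuous.intervalIntegrable (by fun_prop) _ _)]
  rw [show lam * (Real.pi * R ^ 2) = Real.pi * lam * R ^ 2 by ring]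
  simp
  ring

/-! ### The two moments -/

section

variable {Ω : Type*} [MeasurableSpace Ω] {P : Measure Ω} {Φ : Ω → Set Plane} {lam : ℝ}

theorem IsHomogeneousPPP.lintegral_cellCentreArea [SFinite P] (hΦ : IsHomogeneousPPP P Φ lam)
    (hlam : 0 < lam) {R : ℝ} (hR : 0 ≤ R) :
    ∫⁻ ω, volume (cellCentre (withOrigin (Φ ω)) 0 R) ∂P =
      ENNReal.ofReal ((1 - Real.exp (-(Real.pi * lam * R ^ 2))) / lam) := by
  rw [hΦ.lintegral_volume_cellCentre, lintegral_plane_eq_polar _ (hΦ.measurable_prob_cellCentre R),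
    ← integral_exp_neg_mul_sq_mul hlam, ← lintegral_radial_indicator (C := 2 * Real.pi) hR
      (by fun_prop) (fun r _ => by positivity)]
  · refine setLIntegral_congr_fun measurableSet_Ioi fun r hr => ?_
    congr 1
    simp_rw [hΦ.prob_mem_cellCentre hlam.le, norm_polarPoint (le_of_lt hr)]
    rw [lintegral_Ioo_neg_pi_pi_const]
    by_cases h : r ∈ Iic R
    · simp only [indicator_of_mem h]
      rw [ENNReal.ofReal_mul Real.two_pi_pos.le]
    · simp [indicator_of_notMem h]
  · intro r _
    refine mul_le_of_le_one_right Real.two_pi_pos.le (Real.exp_le_one_iff.2 (neg_nonpos.2 ?_))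
    have := hlam.le
    positivity

theorem IsHomogeneousPPP.lintegral_prob_pair [SFinite P] (hΦ : IsHomogeneousPPP P Φ lam)
    (hlam : 0 ≤ lam) {R r₁ : ℝ} (hR : 0 ≤ R) (h₁ : 0 ≤ r₁) (θ₁ : ℝ) :
    ∫⁻ y, P {ω | polarPoint r₁ θ₁ ∈ cellCentre (withOrigin (Φ ω)) 0 R ∧
        y ∈ cellCentre (withOrigin (Φ ω)) 0 R} =
      (Iic R).indicator (fun r₁ => ENNReal.ofReal (radialIntegral lam R r₁)) r₁ := by
  refine (lintegral_plane_eq_polar _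
    ((hΦ.measurable_prob_cellCentre_pair R).comp measurable_prodMk_left)).trans ?_
  have h : ∀ r₂ ∈ Ioi (0 : ℝ), ENNReal.ofReal r₂ * ∫⁻ θ₂ in Ioo (-Real.pi) Real.pi,
      P {ω | polarPoint r₁ θ₁ ∈ cellCentre (withOrigin (Φ ω)) 0 R ∧
        polarPoint r₂ θ₂ ∈ cellCentre (withOrigin (Φ ω)) 0 R} =
      (Iic R).indicator (fun r₁ => ENNReal.ofReal r₂ * (Iic R).indicator
        (fun r₂ => ENNReal.ofReal (angularIntegral lam r₁ r₂)) r₂) r₁ := by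
    intro r₂ h₂
    simp_rw [hΦ.prob_pair_mem_cellCentre hlam h₁ (le_of_lt h₂)]
    by_cases k₁ : r₁ ∈ Iic R
    · by_cases k₂ : r₂ ∈ Iic R
      · simp only [indicator_of_mem k₁, indicator_of_mem k₂]
        rw [lintegral_exp_unionArea hlam h₁ (le_of_lt h₂)]
      · simp [indicator_of_notMem k₂]
    · simp [indicator_of_notMem k₁]
  refine (setLIntegral_congr_fun measurableSet_Ioi h).trans ?_
  by_cases k₁ : r₁ ∈ Iic R
  · simp only [indicator_of_mem k₁]
    have hm : Measurable fun r₂ => angularIntegral lam r₁ r₂ :=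
      Measurable.comp (g := fun p : ℝ × ℝ => angularIntegral lam p.1 p.2) (f := fun r₂ => (r₁, r₂))
        (measurable_angularIntegral lam) (measurable_const.prodMk measurable_id)
    exact lintegral_radial_indicator (C := 2 * Real.pi) hR hm
      (fun r _ => angularIntegral_nonneg _ _ _) (fun r hr => angularIntegral_le hlam h₁ hr.1.le)
  · simp [indicator_of_notMem k₁]

theorem IsHomogeneousPPP.lintegral_cellCentreArea_sq [SFinite P] (hΦ : IsHomogeneousPPP P Φ lam)
    (hlam : 0 ≤ lam) {R : ℝ} (hR : 0 ≤ R) :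
    ∫⁻ ω, volume (cellCentre (withOrigin (Φ ω)) 0 R) ^ 2 ∂P =
      ENNReal.ofReal (2 * Real.pi * ∫ r₁ in (0 : ℝ)..R, radialIntegral lam R r₁ * r₁) := by
  rw [hΦ.lintegral_volume_cellCentre_sq, lintegral_plane_eq_polar _
      (hΦ.measurable_prob_cellCentre_pair R).lintegral_prod_right',
    ENNReal.ofReal_mul Real.two_pi_pos.le,
    ← lintegral_radial_indicator hR (measurable_radialIntegral hR lam)
      (fun r _ => radialIntegral_nonneg hR lam r)
      (fun r hr => radialIntegral_le hR hlam hr.1.le),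
    ← lintegral_const_mul' _ _ ENNReal.ofReal_ne_top]
  refine setLIntegral_congr_fun measurableSet_Ioi fun r hr => ?_
  simp_rw [hΦ.lintegral_prob_pair hlam hR (le_of_lt hr)]
  -- The integral over the second point does not involve the direction of the first, which therefore
  -- contributes the factor `2π`.
  rw [lintegral_Ioo_neg_pi_pi_const, mul_left_comm]

end

theorem lemma3 {Ω : Type*} [MeasurableSpace Ω] (P : Measure Ω) [IsProbabilityMeasure P]
    (Φ : Ω → Set Plane) (lam Rc : ℝ) (hlam : 0 < lam) (hRc : 0 ≤ Rc)
    (hΦ : IsHomogeneousPPP P Φ lam) :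
    (Integrable (fun ω => cellCentreArea (Φ ω) Rc) P ∧
      ∫ ω, cellCentreArea (Φ ω) Rc ∂P = (1 - Real.exp (-(Real.pi * lam * Rc ^ 2))) / lam) ∧
    (Integrable (fun ω => cellCentreArea (Φ ω) Rc ^ 2) P ∧
      ∫ ω, cellCentreArea (Φ ω) Rc ^ 2 ∂P =
        2 * Real.pi * ∫ r₁ in (0 : ℝ)..Rc, (∫ r₂ in (0 : ℝ)..Rc,
          (∫ u in (0 : ℝ)..(2 * Real.pi), Real.exp (-(lam * unionArea r₁ r₂ u))) * r₂) * r₁) ∧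
    (∀ r₁ r₂ u θ : ℝ, 0 ≤ r₁ → 0 ≤ r₂ → u ∈ Icc 0 (2 * Real.pi) →
      volume.real (Metric.closedBall (polarPoint r₁ θ) r₁ ∪
        Metric.closedBall (polarPoint r₂ (θ + u)) r₂) = unionArea r₁ r₂ u) := by
  refine ⟨⟨by simpa using hΦ.integrable_cellCentreArea_pow Rc 1, ?_⟩,
    ⟨hΦ.integrable_cellCentreArea_pow Rc 2, ?_⟩,
    fun r₁ r₂ u θ h₁ h₂ _ => volume_real_union_discs h₁ h₂ u θ⟩
  · rw [integral_eq_lintegral_of_nonneg_ae (ae_of_all _ fun ω => cellCentreArea_nonneg _ _)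
      (hΦ.measurable_cellCentreArea Rc).aestronglyMeasurable]
    simp_rw [ofReal_cellCentreArea]
    rw [hΦ.lintegral_cellCentreArea hlam hRc, ENNReal.toReal_ofReal]
    refine div_nonneg (sub_nonneg.2 (Real.exp_le_one_iff.2 (neg_nonpos.2 ?_))) hlam.le
    positivity
  · rw [integral_eq_lintegral_of_nonneg_ae (ae_of_all _ fun ω => sq_nonneg _)
      ((hΦ.measurable_cellCentreArea Rc).pow_const 2).aestronglyMeasurable]
    simp_rw [ENNReal.ofReal_pow (cellCentreArea_nonneg _ _), ofReal_cellCentreArea]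
    rw [hΦ.lintegral_cellCentreArea_sq hlam.le hRc, ENNReal.toReal_ofReal]
    · rfl
    · exact mul_nonneg Real.two_pi_pos.le (intervalIntegral.integral_nonneg hRc
        fun r hr => mul_nonneg (radialIntegral_nonneg hRc lam r) hr.1)
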